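/- Consider a single-server queue with $K$ customer classes in a random environment. The environment $Z$ is an irreducible continuous-time Markov chain on $\{1,\dots,D\}$ with generator matrix $Q=(q_{d\ell})$ and invariant distribution $(\pi_1,\dots,\pi_D)$. While the environment is in state $d$, customers arrive according to a Poisson process with rate $\lambda_d\ge 0$, an arriving customer is of class $k$ with probability $\alpha_{k,d}$ ($\sum_k\alpha_{k,d}=1$), and the server has capacity $c_d\ge 0$. Put $\lambda_{k,d}=\alpha_{k,d}\lambda_d$, and assume that for each $k$ there is a $d$ with $\lambda_{k,d}>0$. Class-$k$ customers have exponentially distributed service requirements with mean $1/\mu_k$, $\mu_k>0$, and the server works under discriminatory processor sharing with weights $g_1,\dots,g_K>0$. Thus, with $M_k$ the number of class-$k$ customers and $\mu_{k,d}=\mu_k c_d$, the pair $(\vec M,Z)$ is the continuous-time Markov chain on $\mathbb N^K\times\{1,\dots,D\}$ with the following transition rates out of a state $(\vec m,d)$: $\lambda_{k,d}$ to $(\vec m+\vec e_k,d)$; $\mu_{k,d}\,g_km_k/\sum_j g_jm_j$ to $(\vec m-\vec e_k,d)$ if $m_k>0$; and $q_{d\ell}$ to $(\vec m,\ell)$ for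 $\ell\neq d$. Let $\lambda_{k,\infty}=\sum_d\lambda_{k,d}\pi_d$. Suppose that the queue is stable, that is, that this Markov chain has a stationary distribution, and let $(\vec M,Z)=(M_1,\dots,M_K,Z)$ be in steady state, that is, distributed according to a stationary distribution. Then, for every $k=1,\dots,K$, \[ \lambda_{k,\infty} = \sum_{d=1}^D \mu_{k,d}\, \mathbb E\left[\frac{g_k M_k}{\sum_j g_j M_j}\cdot \mathbf 1_{\{\sum_j M_j>0 \}} \cdot \mathbf 1_{\{Z=d\}} \right]. \] Furthermore, $\mathbb E[M_k]<\infty$ for every $k$, and the state-dependent expectations of the $M_k$ satisfy \[ \sum_{d=1}^D c_d\, \mathbb E[M_k \mathbf 1_{\{Z=d\}} ]= \frac{\lambda_{k,\infty}}{\mu_k} + \sum_{d=1}^D\sum_{j=1}^K g_j\,\frac{\lambda_{k,d}\, \mathbb E[M_j \mathbf 1_{\{Z=d\}} ] + \lambda_{j,d}\, \mathbb E[M_k\mathbf 1_{\{Z=d\}}] } {\mu_kg_k + \mu_jg_j}. \] -/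

import Mathlib

open MeasureTheory
open scoped BoundedContinuousFunction

/-- The uniformly continuous semigroup `exp (t A)` generated by a bounded operator `A`. -/
noncomputable def expSemigroup {E : Type*} [NormedAddCommGroup E] [NormedSpace ℝ E]
    (A : E →L[ℝ] E) (t : ℝ) : E →L[ℝ] E :=
  NormedSpace.exp (t • A)

/-- Parameters of the Markov-modulated multi-class `M/M/1` queue under discriminatory processor
sharing, with customer classes `Fin K` and environment states `Fin D`. -/
structure ModulatedDPS (K D : ℕ) where
  /-- generator matrix of the environment -/
  Q : Matrix (Fin D) (Fin D) ℝ
  /-- total Poisson arrival rate in each environment state -/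
  lam : Fin D → ℝ
  /-- `alpha k d` is the probability that a customer arriving in state `d` is of class `k` -/
  alpha : Fin K → Fin D → ℝ
  /-- a class-`k` service requirement is exponential with mean `1 / mu k` -/
  mu : Fin K → ℝ
  /-- service capacity in each environment state -/
  c : Fin D → ℝ
  /-- weights of the classes -/
  g : Fin K → ℝ
  Q_offDiag_nonneg : ∀ d l, d ≠ l → 0 ≤ Q d l
  Q_row_sum : ∀ d, ∑ l, Q d l = 0
  Q_irreducible : ∀ d l, Relation.ReflTransGen (fun a b => 0 < Q a b) d l
  lam_nonneg : ∀ d, 0 ≤ lam d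
  alpha_nonneg : ∀ k d, 0 ≤ alpha k d
  alpha_sum : ∀ d, ∑ k, alpha k d = 1
  exists_arrival_pos : ∀ k, ∃ d, 0 < alpha k d * lam d
  mu_pos : ∀ k, 0 < mu k
  c_nonneg : ∀ d, 0 ≤ c d
  g_pos : ∀ k, 0 < g k

namespace ModulatedDPS

variable {K D : ℕ} (S : ModulatedDPS K D)

/-- Arrival rate `λ_{k,d}` of class-`k` customers in environment state `d`. -/
def arrivalRate (k : Fin K) (d : Fin D) : ℝ := S.alpha k d * S.lam d

/-- Service rate `μ_{k,d} = μ_k c_d` of class `k` in environment state `d`. -/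
def serviceRate (k : Fin K) (d : Fin D) : ℝ := S.mu k * S.c d

/-- `p` is an invariant distribution of the environment. -/
def IsInvariantEnv (p : Fin D → ℝ) : Prop :=
  (∀ d, 0 ≤ p d) ∧ ∑ d, p d = 1 ∧ Matrix.vecMul p S.Q = 0

/-- Average arrival rate `λ_{k,∞}` of class `k`, with respect to a distribution `p` of the
environment. -/
def avgArrivalRate (p : Fin D → ℝ) (k : Fin K) : ℝ := ∑ d, S.arrivalRate k d * p d

/-- Fraction `g_k m_k / ∑_j g_j m_j` of the capacity that is given to class `k` as a whole when the
queue length vector is `m`; it is `0` if the queue is empty. -/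
noncomputable def share (k : Fin K) (m : Fin K → ℕ) : ℝ :=
  S.g k * m k / ∑ j, S.g j * m j

/-- The action of the infinitesimal generator of the Markov chain `(M, Z)` on functions of the
state `(m, d)`: class-`k` arrivals at rate `λ_{k,d}`, class-`k` departures at rate
`μ_{k,d} g_k m_k / ∑_j g_j m_j`, and changes of the environment from `d` to `l` at rate `Q d l`. -/
noncomputable def generatorFun (f : (Fin K → ℕ) × Fin D → ℝ) (x : (Fin K → ℕ) × Fin D) : ℝ :=
  ∑ k, S.arrivalRate k x.2 * (f (x.1 + Pi.single k 1, x.2) - f x)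
    + ∑ k, S.serviceRate k x.2 * S.share k x.1 * (f (x.1 - Pi.single k 1, x.2) - f x)
    + ∑ l, S.Q x.2 l * (f (x.1, l) - f x)

theorem share_nonneg (k : Fin K) (m : Fin K → ℕ) : 0 ≤ S.share k m :=
  div_nonneg (mul_nonneg (S.g_pos k).le (Nat.cast_nonneg _))
    (Finset.sum_nonneg fun j _ => mul_nonneg (S.g_pos j).le (Nat.cast_nonneg _))

theorem share_le_one (k : Fin K) (m : Fin K → ℕ) : S.share k m ≤ 1 :=
  div_le_one_of_le₀
    (Finset.single_le_sum (f := fun j => S.g j * (m j : ℝ))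
      (fun j _ => mul_nonneg (S.g_pos j).le (Nat.cast_nonneg _)) (Finset.mem_univ k))
    (Finset.sum_nonneg fun j _ => mul_nonneg (S.g_pos j).le (Nat.cast_nonneg _))

/-- A bound on all transition rates out of a state. -/
def rateBound : ℝ :=
  ∑ d, (∑ k, |S.arrivalRate k d| + ∑ k, |S.serviceRate k d| + ∑ l, |S.Q d l|)

theorem generatorFun_bound (f : (Fin K → ℕ) × Fin D →ᵇ ℝ) (x : (Fin K → ℕ) × Fin D) :
    ‖S.generatorFun f x‖ ≤ 2 * S.rateBound * ‖f‖ := by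
  have hf : ∀ y, |f y - f x| ≤ 2 * ‖f‖ := fun y => by
    have h1 := f.norm_coe_le_norm y
    have h2 := f.norm_coe_le_norm x
    rw [Real.norm_eq_abs] at h1 h2
    have h3 := abs_sub (f y) (f x)
    linarith
  have h1 : |∑ k, S.arrivalRate k x.2 * (f (x.1 + Pi.single k 1, x.2) - f x)|
      ≤ (∑ k, |S.arrivalRate k x.2|) * (2 * ‖f‖) := by
    rw [Finset.sum_mul]
    refine (Finset.abs_sum_le_sum_abs _ _).trans (Finset.sum_le_sum fun k _ => ?_)
    rw [abs_mul]
    exact mul_le_mul_of_nonneg_left (hf _) (abs_nonneg _)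
  have h2 : |∑ k, S.serviceRate k x.2 * S.share k x.1 * (f (x.1 - Pi.single k 1, x.2) - f x)|
      ≤ (∑ k, |S.serviceRate k x.2|) * (2 * ‖f‖) := by
    rw [Finset.sum_mul]
    refine (Finset.abs_sum_le_sum_abs _ _).trans (Finset.sum_le_sum fun k _ => ?_)
    rw [abs_mul, abs_mul, abs_of_nonneg (S.share_nonneg k x.1)]
    exact mul_le_mul (mul_le_of_le_one_right (abs_nonneg _) (S.share_le_one k x.1)) (hf _)
      (abs_nonneg _) (abs_nonneg _)
  have h3 : |∑ l, S.Q x.2 l * (f (x.1, l) - f x)| ≤ (∑ l, |S.Q x.2 l|) * (2 * ‖f‖) := by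
    rw [Finset.sum_mul]
    refine (Finset.abs_sum_le_sum_abs _ _).trans (Finset.sum_le_sum fun k _ => ?_)
    rw [abs_mul]
    exact mul_le_mul_of_nonneg_left (hf _) (abs_nonneg _)
  have h4 : (∑ k, |S.arrivalRate k x.2| + ∑ k, |S.serviceRate k x.2| + ∑ l, |S.Q x.2 l|)
      ≤ S.rateBound :=
    Finset.single_le_sum
      (f := fun d => ∑ k, |S.arrivalRate k d| + ∑ k, |S.serviceRate k d| + ∑ l, |S.Q d l|)
      (fun d _ => by positivity) (Finset.mem_univ x.2)
  have h5 := mul_le_mul_of_nonneg_right h4 (by positivity : 0 ≤ 2 * ‖f‖)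
  rw [Real.norm_eq_abs]
  unfold generatorFun
  refine (abs_add_three _ _ _).trans ?_
  nlinarith

/-- The infinitesimal generator of `(M, Z)` as a bounded operator on the bounded functions on the
(discrete) state space. -/
noncomputable def generator :
    ((Fin K → ℕ) × Fin D →ᵇ ℝ) →L[ℝ] ((Fin K → ℕ) × Fin D →ᵇ ℝ) :=
  LinearMap.mkContinuous
    { toFun := fun f => BoundedContinuousFunction.ofNormedAddCommGroupDiscrete
        (S.generatorFun f) _ (S.generatorFun_bound f)
      map_add' := fun f g => by
        ext x
        simp only [BoundedContinuousFunction.coe_ofNormedAddCommGroupDiscrete,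
          BoundedContinuousFunction.coe_add, Pi.add_apply, generatorFun, add_sub_add_comm,
          mul_add, Finset.sum_add_distrib]
        ring
      map_smul' := fun a f => by
        ext x
        simp only [BoundedContinuousFunction.coe_ofNormedAddCommGroupDiscrete,
          BoundedContinuousFunction.coe_smul, smul_eq_mul, generatorFun, RingHom.id_apply,
          ← mul_sub, mul_left_comm _ a, ← Finset.mul_sum]
        ring }
    (2 * S.rateBound) (fun f => BoundedContinuousFunction.norm_ofNormedAddCommGroup_le _
      (mul_nonneg (mul_nonneg zero_le_two
        (Finset.sum_nonneg fun _ _ => by positivity)) (norm_nonneg _)) (S.generatorFun_bound f))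

@[simp] theorem generator_apply (f : (Fin K → ℕ) × Fin D →ᵇ ℝ) (x : (Fin K → ℕ) × Fin D) :
    S.generator f x = S.generatorFun f x := rfl

/-- The transition semigroup of the Markov chain `(M(t), Z(t))`: `S.semigroup t f x` is the
expectation of `f (M(t), Z(t))` for the chain started in `x`. All transition rates are bounded, so
that the semigroup is the exponential of its generator. -/
noncomputable def semigroup (t : ℝ) :
    ((Fin K → ℕ) × Fin D →ᵇ ℝ) →L[ℝ] ((Fin K → ℕ) × Fin D →ᵇ ℝ) :=
  expSemigroup S.generator t

/-- `ν` is a steady-state (stationary) distribution of the Markov chain `(M(t), Z(t))`. -/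
def IsSteadyState (ν : Measure ((Fin K → ℕ) × Fin D)) : Prop :=
  IsProbabilityMeasure ν ∧
    ∀ t : ℝ, 0 ≤ t → ∀ f : (Fin K → ℕ) × Fin D →ᵇ ℝ, ∫ x, S.semigroup t f x ∂ν = ∫ x, f x ∂ν

end ModulatedDPS

/-! Write `G` for the generator and `V` for the mean workload plus a function of the environment.
Everything follows from `E[G f (M, Z)] = 0` with well-chosen `f`. For bounded `f` this is the
derivative at `t = 0` of the stationarity identity; truncating the queue lengths extends it to every
`f` whose increments, rather than values, are suitably dominated
(`IsSteadyState.integral_generatorFun`).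

Rate conservation is the case `f = M_k`. The last identity is the case `f = M_j M_k`: since `share_k
M_j` and `share_j M_k` are both proportional to `M_j M_k / ∑ g_i M_i`, each pair `(j, k)` gives one
equation for the single unknown `E[c_Z share_j M_k]`. Solving it and summing over `j`, where the
shares add up to one, gives `E[c_Z M_k]`.

The product `M_j M_k` is an admissible `f` once first moments are finite, which is the main work.
Stationarity forces mean load below mean capacity, because the empty queue is charged in a state
with positive capacity (`dotProduct_load_lt`). Solving the Poisson equation of the environment then
gives `V` a constant negative drift off the empty queue (`exists_potential`). A bounded substitute
for `V ^ 2 / 2` turns this drift into a bound on truncated means of `V` (`exists_integral_tent_le`),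
and hence into `E[V] < ∞`. -/

namespace ModulatedDPS

variable {K D : ℕ} (S : ModulatedDPS K D)

/-! ### Invariant distributions of the environment -/

/-- Maximum principle: `Q`-harmonic functions are constant. -/
theorem const_of_mulVec_eq_zero {v : Fin D → ℝ} (hv : S.Q.mulVec v = 0) (a b : Fin D) :
    v a = v b := by
  obtain ⟨i, -, hi⟩ := Finset.exists_max_image Finset.univ v ⟨a, Finset.mem_univ a⟩
  have key : ∀ d, v d = v i := by
    intro d
    induction S.Q_irreducible i d with
    | refl => rfl
    | @tail b d _ hbd ih =>
      -- Rows of `Q` sum to zero. At a maximum `b` every term of this sum is nonnegative, so `v`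
      -- agrees with `v b` across each edge leaving `b`.
      have h0 : ∑ l, S.Q b l * (v b - v l) = 0 := by
        have := congrFun hv b
        simp only [Matrix.mulVec, dotProduct, Pi.zero_apply] at this
        simp only [mul_sub, Finset.sum_sub_distrib, ← Finset.sum_mul, S.Q_row_sum, this]
        ring
      have h1 := (Finset.sum_eq_zero_iff_of_nonneg (fun l _ => by
        rcases eq_or_ne b l with rfl | hl
        · simp
        · exact mul_nonneg (S.Q_offDiag_nonneg b l hl)
            (sub_nonneg.2 (ih ▸ hi l (Finset.mem_univ l))))).1 h0 d (Finset.mem_univ d)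
      rcases mul_eq_zero.1 h1 with h | h
      · exact absurd h hbd.ne'
      · linarith
  rw [key a, key b]

variable {S}

theorem IsInvariantEnv.dotProduct_one {p : Fin D → ℝ} (hp : S.IsInvariantEnv p) :
    p ⬝ᵥ 1 = 1 := by
  simpa [dotProduct] using hp.2.1

/-- Invariance of `p` gives one inclusion. The maximum principle makes the kernel of `Q` at most
one-dimensional, so the range is at least as large as the hyperplane orthogonal to `p`. -/
theorem IsInvariantEnv.range_mulVecLin {p : Fin D → ℝ} (hp : S.IsInvariantEnv p) :
    LinearMap.range S.Q.mulVecLin = LinearMap.ker (dotProductBilin ℝ ℝ p) := by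
  refine Submodule.eq_of_le_of_finrank_le ?_ ?_
  · rintro _ ⟨h, rfl⟩
    change p ⬝ᵥ S.Q.mulVec h = 0
    rw [Matrix.dotProduct_mulVec, hp.2.2, zero_dotProduct]
  · have h1 := S.Q.mulVecLin.finrank_range_add_finrank_ker
    have h2 := (dotProductBilin ℝ ℝ p).finrank_range_add_finrank_ker
    have h3 : Module.finrank ℝ (LinearMap.ker S.Q.mulVecLin) ≤ 1 := by
      have h : LinearMap.ker S.Q.mulVecLin ≤ Submodule.span ℝ {1} := fun v hv => by
        rcases isEmpty_or_nonempty (Fin D) with hD | ⟨⟨a⟩⟩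
        · rw [Subsingleton.elim v 0]; exact zero_mem _
        · refine Submodule.mem_span_singleton.2 ⟨v a, funext fun b => ?_⟩
          simpa using S.const_of_mulVec_eq_zero hv a b
      refine (Submodule.finrank_mono h).trans ?_
      simpa using finrank_span_le_card (R := ℝ) ({1} : Set (Fin D → ℝ))
    have h4 : dotProductBilin ℝ ℝ p ≠ 0 := fun h => by
      have : p ⬝ᵥ 1 = 0 := LinearMap.congr_fun h 1
      rw [hp.dotProduct_one] at this
      exact one_ne_zero this
    have h5 := LinearMap.range_eq_top.2 (LinearMap.surjective h4)
    rw [h5, finrank_top, Module.finrank_self] at h2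
    omega

/-- The Poisson equation of the environment is solvable. -/
theorem IsInvariantEnv.exists_mulVec_eq {p : Fin D → ℝ} (hp : S.IsInvariantEnv p)
    {r : Fin D → ℝ} (hr : p ⬝ᵥ r = 0) : ∃ h : Fin D → ℝ, S.Q.mulVec h = r := by
  have : r ∈ LinearMap.range S.Q.mulVecLin := by
    rw [hp.range_mulVecLin]; exact hr
  exact this

/-- Positivity spreads along edges: if `p d = 0`, the balance equation at `d` has only nonnegative
terms, so no mass can flow in from a charged `b`. -/
theorem IsInvariantEnv.pos {p : Fin D → ℝ} (hp : S.IsInvariantEnv p) (d : Fin D) : 0 < p d := by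
  obtain ⟨a, -, ha⟩ : ∃ a ∈ Finset.univ, 0 < p a := by
    by_contra! h
    have := Finset.sum_nonpos h
    linarith [hp.2.1]
  induction S.Q_irreducible a d with
  | refl => exact ha
  | @tail b d _ hbd ih =>
    refine (hp.1 d).lt_of_ne' fun h0 => ?_
    have hbd' : b ≠ d := by rintro rfl; exact ih.ne' h0
    have h1 : ∑ l, p l * S.Q l d = 0 := congrFun hp.2.2 d
    have h2 := (Finset.sum_eq_zero_iff_of_nonneg (fun l _ => by
      rcases eq_or_ne l d with rfl | hl
      · simp [h0]
      · exact mul_nonneg (hp.1 l) (S.Q_offDiag_nonneg l d hl))).1 h1 b (Finset.mem_univ b)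
    exact (mul_pos ih hbd).ne' h2

/-! ### The generator -/

variable (S)

theorem generatorFun_sub_mul (f g : (Fin K → ℕ) × Fin D → ℝ) (a : ℝ)
    (x : (Fin K → ℕ) × Fin D) :
    S.generatorFun (fun y => f y - a * g y) x = S.generatorFun f x - a * S.generatorFun g x := by
  simp only [generatorFun, mul_add, Finset.mul_sum]
  rw [add_sub_add_comm, add_sub_add_comm, ← Finset.sum_sub_distrib, ← Finset.sum_sub_distrib,
    ← Finset.sum_sub_distrib]
  congr 1
  · congr 1 <;> exact Finset.sum_congr rfl fun _ _ => by ring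
  · exact Finset.sum_congr rfl fun _ _ => by ring

/-- Only the increments of `f` at the one point `x` enter, so `f` may be unbounded and `b` may
depend on `x`. -/
theorem abs_generatorFun_le {f : (Fin K → ℕ) × Fin D → ℝ} {x : (Fin K → ℕ) × Fin D} {b : ℝ}
    (hb : 0 ≤ b)
    (h₁ : ∀ k, |f (x.1 + Pi.single k 1, x.2) - f x| ≤ b)
    (h₂ : ∀ k, |f (x.1 - Pi.single k 1, x.2) - f x| ≤ b)
    (h₃ : ∀ l, |f (x.1, l) - f x| ≤ b) :
    |S.generatorFun f x| ≤ S.rateBound * b := by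
  have e1 : |∑ k, S.arrivalRate k x.2 * (f (x.1 + Pi.single k 1, x.2) - f x)|
      ≤ (∑ k, |S.arrivalRate k x.2|) * b := by
    rw [Finset.sum_mul]
    refine (Finset.abs_sum_le_sum_abs _ _).trans (Finset.sum_le_sum fun k _ => ?_)
    rw [abs_mul]
    exact mul_le_mul_of_nonneg_left (h₁ _) (abs_nonneg _)
  have e2 : |∑ k, S.serviceRate k x.2 * S.share k x.1 * (f (x.1 - Pi.single k 1, x.2) - f x)|
      ≤ (∑ k, |S.serviceRate k x.2|) * b := by
    rw [Finset.sum_mul]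
    refine (Finset.abs_sum_le_sum_abs _ _).trans (Finset.sum_le_sum fun k _ => ?_)
    rw [abs_mul, abs_mul, abs_of_nonneg (S.share_nonneg k x.1)]
    exact mul_le_mul (mul_le_of_le_one_right (abs_nonneg _) (S.share_le_one k x.1)) (h₂ _)
      (abs_nonneg _) (abs_nonneg _)
  have e3 : |∑ l, S.Q x.2 l * (f (x.1, l) - f x)| ≤ (∑ l, |S.Q x.2 l|) * b := by
    rw [Finset.sum_mul]
    refine (Finset.abs_sum_le_sum_abs _ _).trans (Finset.sum_le_sum fun k _ => ?_)
    rw [abs_mul]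
    exact mul_le_mul_of_nonneg_left (h₃ _) (abs_nonneg _)
  have e4 : (∑ k, |S.arrivalRate k x.2| + ∑ k, |S.serviceRate k x.2| + ∑ l, |S.Q x.2 l|)
      ≤ S.rateBound :=
    Finset.single_le_sum
      (f := fun d => ∑ k, |S.arrivalRate k d| + ∑ k, |S.serviceRate k d| + ∑ l, |S.Q d l|)
      (fun d _ => by positivity) (Finset.mem_univ x.2)
  unfold generatorFun
  refine (abs_add_three _ _ _).trans (le_trans ?_ (mul_le_mul_of_nonneg_right e4 hb))
  linarith

theorem abs_generatorFun_le_of_bounded {f : (Fin K → ℕ) × Fin D → ℝ} {C : ℝ}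
    (hf : ∀ x, |f x| ≤ C) (x : (Fin K → ℕ) × Fin D) :
    |S.generatorFun f x| ≤ S.rateBound * (2 * C) := by
  have h : ∀ y, |f y - f x| ≤ 2 * C := fun y => by
    have := abs_sub (f y) (f x); linarith [hf x, hf y]
  exact S.abs_generatorFun_le ((abs_nonneg _).trans (h x)) (fun _ => h _) (fun _ => h _)
    fun _ => h _

theorem serviceRate_nonneg (k : Fin K) (d : Fin D) : 0 ≤ S.serviceRate k d :=
  mul_nonneg (S.mu_pos k).le (S.c_nonneg d)

theorem arrivalRate_nonneg (k : Fin K) (d : Fin D) : 0 ≤ S.arrivalRate k d :=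
  mul_nonneg (S.alpha_nonneg k d) (S.lam_nonneg d)

theorem share_eq_zero {k : Fin K} {m : Fin K → ℕ} (h : m k = 0) : S.share k m = 0 := by
  simp [share, h]

theorem sum_g_mul_pos {m : Fin K → ℕ} (h : m ≠ 0) : 0 < ∑ j, S.g j * (m j : ℝ) := by
  obtain ⟨k, hk⟩ := Function.ne_iff.1 h
  exact Finset.sum_pos' (fun j _ => mul_nonneg (S.g_pos j).le (Nat.cast_nonneg _))
    ⟨k, Finset.mem_univ k, mul_pos (S.g_pos k) (Nat.cast_pos.2 (Nat.pos_of_ne_zero hk))⟩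

theorem sum_share {m : Fin K → ℕ} (h : m ≠ 0) : ∑ k, S.share k m = 1 := by
  simp only [share, ← Finset.sum_div]
  exact div_self (S.sum_g_mul_pos h).ne'

theorem share_pos {k : Fin K} {m : Fin K → ℕ} (h : m k ≠ 0) : 0 < S.share k m :=
  div_pos (mul_pos (S.g_pos k) (Nat.cast_pos.2 (Nat.pos_of_ne_zero h)))
    (S.sum_g_mul_pos fun h' => h (by simp [h']))

/-! ### Stationary distributions -/

variable {S} {ν : Measure ((Fin K → ℕ) × Fin D)}

/-- The integral of a bounded generator image against a stationary distribution vanishes. -/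
theorem IsSteadyState.integral_generatorFun_of_bounded (hν : S.IsSteadyState ν)
    {f : (Fin K → ℕ) × Fin D → ℝ} {C : ℝ} (hf : ∀ x, |f x| ≤ C) :
    ∫ x, S.generatorFun f x ∂ν = 0 := by
  have := hν.1
  let F : (Fin K → ℕ) × Fin D →ᵇ ℝ :=
    BoundedContinuousFunction.ofNormedAddCommGroupDiscrete f C hf
  let I : ((Fin K → ℕ) × Fin D →ᵇ ℝ) →L[ℝ] ℝ := LinearMap.mkContinuous
    { toFun := fun g => ∫ x, g x ∂ν
      map_add' := fun g h => integral_add (g.integrable ν) (h.integrable ν)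
      map_smul' := fun a g => integral_const_mul a g } 1 (fun g => by
        simpa using g.norm_integral_le_norm (μ := ν))
  have h1 : HasDerivAt (fun t : ℝ => S.semigroup t) S.generator 0 := by
    simpa [semigroup, expSemigroup] using hasDerivAt_exp_smul_const (𝕂 := ℝ) S.generator (0 : ℝ)
  have h2 : HasDerivAt (fun t : ℝ => I (S.semigroup t F)) (I (S.generator F)) 0 := by
    have := (h1.clm_apply (hasDerivAt_const (0 : ℝ) F))
    have := I.hasFDerivAt.comp_hasDerivAt (0 : ℝ) this
    simpa [Function.comp_def] using this
  -- Stationarity speaks of `t ≥ 0` only, so the two derivatives are compared from the right.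
  have h3 : HasDerivWithinAt (fun t : ℝ => I (S.semigroup t F)) 0 (Set.Ici 0) 0 :=
    (hasDerivWithinAt_const (0 : ℝ) (Set.Ici 0) (I F)).congr (fun t ht => hν.2 t ht F)
      (hν.2 0 le_rfl F)
  exact (uniqueDiffOn_Ici (0 : ℝ) 0 Set.self_mem_Ici).eq_deriv _ h2.hasDerivWithinAt h3

theorem integrable_of_bounded [IsFiniteMeasure ν] {f : (Fin K → ℕ) × Fin D → ℝ} {C : ℝ}
    (hf : ∀ x, |f x| ≤ C) : Integrable f ν :=
  Integrable.of_bound (Measurable.of_discrete.aestronglyMeasurable) C (ae_of_all _ hf)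

theorem generatorFun_snd (h : Fin D → ℝ) (x : (Fin K → ℕ) × Fin D) :
    S.generatorFun (fun y => h y.2) x = S.Q.mulVec h x.2 := by
  simp [generatorFun, Matrix.mulVec, dotProduct, mul_sub, Finset.sum_sub_distrib,
    ← Finset.sum_mul, S.Q_row_sum]

theorem abs_le_sum_abs (u : Fin D → ℝ) (d : Fin D) : |u d| ≤ ∑ l, |u l| :=
  Finset.single_le_sum (f := fun l => |u l|) (fun _ _ => abs_nonneg _) (Finset.mem_univ d)

/-- The environment marginal of a stationary distribution is the invariant distribution. -/
theorem IsSteadyState.integral_snd (hν : S.IsSteadyState ν) {p : Fin D → ℝ}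
    (hp : S.IsInvariantEnv p) (u : Fin D → ℝ) : ∫ x, u x.2 ∂ν = p ⬝ᵥ u := by
  have := hν.1
  -- Centring `u` puts it in the range of `Q`; the test function `h(Z)` then shows that its centred
  -- mean is zero.
  obtain ⟨h, hh⟩ := hp.exists_mulVec_eq (r := u - (p ⬝ᵥ u) • 1) (by
    rw [dotProduct_sub, dotProduct_smul, hp.dotProduct_one]; simp)
  have h0 := hν.integral_generatorFun_of_bounded (f := fun y => h y.2)
    (fun x => abs_le_sum_abs h x.2)
  simp only [generatorFun_snd, hh, Pi.sub_apply, Pi.smul_apply, Pi.one_apply, smul_eq_mul,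
    mul_one] at h0
  rw [integral_sub (integrable_of_bounded fun x => abs_le_sum_abs u x.2) (integrable_const _)] at h0
  simpa [sub_eq_zero] using h0

/-! ### Unbounded test functions -/

/-- A jump of `m` either induces the same jump of the truncated vector or leaves it fixed.
Increments of a truncated test function are thus increments of the original at the truncated point,
or zero. -/
theorem add_single_inf_const (m : Fin K → ℕ) (N : ℕ) (k : Fin K) :
    (m + Pi.single k 1) ⊓ (fun _ => N) = m ⊓ (fun _ => N) + Pi.single k 1 ∨
      (m + Pi.single k 1) ⊓ (fun _ => N) = m ⊓ (fun _ => N) := by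
  by_cases h : m k < N
  · left; ext j
    rcases eq_or_ne j k with rfl | hj
    · simp; omega
    · simp [hj]
  · right; ext j
    rcases eq_or_ne j k with rfl | hj
    · simp; omega
    · simp [hj]

theorem sub_single_inf_const (m : Fin K → ℕ) (N : ℕ) (k : Fin K) :
    (m - Pi.single k 1) ⊓ (fun _ => N) = m ⊓ (fun _ => N) - Pi.single k 1 ∨
      (m - Pi.single k 1) ⊓ (fun _ => N) = m ⊓ (fun _ => N) := by
  by_cases h : m k ≤ N
  · left; ext j
    rcases eq_or_ne j k with rfl | hj
    · simp; omega
    · simp [hj]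
  · right; ext j
    rcases eq_or_ne j k with rfl | hj
    · simp; omega
    · simp [hj]

/-- The stationarity equation holds for every test function whose increments along the transitions
are dominated by an integrable function that increases with the queue lengths. -/
theorem IsSteadyState.integral_generatorFun (hν : S.IsSteadyState ν)
    {f B : (Fin K → ℕ) × Fin D → ℝ} (hB : Integrable B ν) (hB₀ : ∀ x, 0 ≤ B x)
    (hmono : ∀ m n d, m ≤ n → B (m, d) ≤ B (n, d))
    (h₁ : ∀ m d k, |f (m + Pi.single k 1, d) - f (m, d)| ≤ B (m, d))
    (h₂ : ∀ m d k, |f (m - Pi.single k 1, d) - f (m, d)| ≤ B (m, d))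
    (h₃ : ∀ m d l, |f (m, l) - f (m, d)| ≤ B (m, d)) :
    ∫ x, S.generatorFun f x ∂ν = 0 := by
  let T : ℕ → (Fin K → ℕ) × Fin D → ℝ := fun N x => f (x.1 ⊓ (fun _ => N), x.2)
  have hT : ∀ x, ∀ᶠ N in Filter.atTop, T N x = f x := fun x => by
    filter_upwards [Filter.eventually_ge_atTop (∑ k, x.1 k)] with N hN
    have : x.1 ⊓ (fun _ => N) = x.1 := inf_eq_left.2 fun k =>
      (Finset.single_le_sum (f := x.1) (fun _ _ => Nat.zero_le _) (Finset.mem_univ k)).trans hN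
    simp only [T, this]
  have hlim : ∀ x, Filter.Tendsto (fun N => S.generatorFun (T N) x) Filter.atTop
      (nhds (S.generatorFun f x)) := fun x => by
    have ht : ∀ y, Filter.Tendsto (fun N => T N y) Filter.atTop (nhds (f y)) := fun y =>
      tendsto_const_nhds.congr' ((hT y).mono fun _ h => h.symm)
    unfold generatorFun
    exact ((tendsto_finsetSum _ fun k _ => ((ht _).sub (ht _)).const_mul _).add
      (tendsto_finsetSum _ fun k _ => ((ht _).sub (ht _)).const_mul _)).add
      (tendsto_finsetSum _ fun k _ => ((ht _).sub (ht _)).const_mul _)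
  -- Increments are taken at the truncated point, which lies below `x`; monotonicity of `B` makes
  -- the bound independent of `N`.
  have hbd : ∀ N x, |S.generatorFun (T N) x| ≤ S.rateBound * B x := fun N x => by
    have hle : B (x.1 ⊓ (fun _ => N), x.2) ≤ B x := hmono _ _ _ inf_le_left
    refine S.abs_generatorFun_le (hB₀ x) (fun k => ?_) (fun k => ?_) fun l => ?_
    · rcases add_single_inf_const x.1 N k with h | h
      · simp only [T, h]; exact (h₁ _ _ _).trans hle
      · simp [T, h, hB₀ x]
    · rcases sub_single_inf_const x.1 N k with h | h
      · simp only [T, h]; exact (h₂ _ _ _).trans hle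
      · simp [T, h, hB₀ x]
    · exact (h₃ _ _ _).trans hle
  have h0 : ∀ N, ∫ x, S.generatorFun (T N) x ∂ν = 0 := fun N =>
    hν.integral_generatorFun_of_bounded
      (C := ∑ y ∈ Finset.Iic (fun _ : Fin K => N) ×ˢ (Finset.univ : Finset (Fin D)), |f y|)
      fun x => Finset.single_le_sum (f := fun y => |f y|) (fun _ _ => abs_nonneg _)
        (Finset.mem_product.2 ⟨Finset.mem_Iic.2 inf_le_right, Finset.mem_univ _⟩)
  have := tendsto_integral_of_dominated_convergence (μ := ν) (fun x => S.rateBound * B x)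
    (fun N => Measurable.of_discrete.aestronglyMeasurable) (hB.const_mul _)
    (fun N => ae_of_all _ (hbd N)) (ae_of_all _ hlim)
  simp only [h0] at this
  exact tendsto_nhds_unique this tendsto_const_nhds

/-! ### Rate conservation -/

theorem cast_sub_single (m : Fin K → ℕ) (k j : Fin K) (h : m k ≠ 0) :
    ((m - Pi.single k 1 : Fin K → ℕ) j : ℝ) = m j - (if j = k then 1 else 0) := by
  rcases eq_or_ne j k with rfl | hj
  · simp [Nat.cast_sub (Nat.one_le_iff_ne_zero.2 h)]
  · simp [hj]

theorem cast_add_single (m : Fin K → ℕ) (k j : Fin K) :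
    ((m + Pi.single k 1 : Fin K → ℕ) j : ℝ) = m j + (if j = k then 1 else 0) := by
  rcases eq_or_ne j k with rfl | hj
  · simp
  · simp [hj]

theorem sub_single_of_eq_zero {m : Fin K → ℕ} {k : Fin K} (h : m k = 0) :
    m - Pi.single k 1 = m := by
  ext i
  rcases eq_or_ne i k with rfl | hi
  · simp [h]
  · simp [hi]

theorem abs_cast_sub_single (m : Fin K → ℕ) (k j : Fin K) :
    |((m - Pi.single k 1 : Fin K → ℕ) j : ℝ) - m j| ≤ 1 := by
  by_cases h : m k = 0
  · rw [sub_single_of_eq_zero h]; simp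
  · rw [cast_sub_single m k j h]
    split_ifs <;> simp

theorem abs_cast_add_single (m : Fin K → ℕ) (k j : Fin K) :
    |((m + Pi.single k 1 : Fin K → ℕ) j : ℝ) - m j| ≤ 1 := by
  rw [cast_add_single m k j]
  split_ifs <;> simp

/-- In the departure part of the generator only the states with a customer to depart matter. -/
theorem share_mul_congr {k : Fin K} {m : Fin K → ℕ} {a b : ℝ} (h : m k ≠ 0 → a = b) :
    S.share k m * a = S.share k m * b := by
  by_cases hk : m k = 0
  · simp [S.share_eq_zero hk]
  · rw [h hk]

theorem generatorFun_coord (k : Fin K) (x : (Fin K → ℕ) × Fin D) :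
    S.generatorFun (fun y => (y.1 k : ℝ)) x =
      S.arrivalRate k x.2 - S.serviceRate k x.2 * S.share k x.1 := by
  have h : ∀ j, S.serviceRate j x.2 * S.share j x.1 *
      (((x.1 - Pi.single j 1 : Fin K → ℕ) k : ℝ) - (x.1 k : ℝ)) =
      if k = j then -(S.serviceRate j x.2 * S.share j x.1) else 0 := fun j => by
    rw [mul_assoc, share_mul_congr (b := -(if k = j then 1 else 0)) fun hj => by
      rw [cast_sub_single _ _ _ hj]; ring]
    split_ifs <;> ring
  simp only [generatorFun, h, cast_add_single]
  simp [sub_eq_add_neg]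

theorem abs_serviceRate_mul_share_le (k : Fin K) (x : (Fin K → ℕ) × Fin D) :
    |S.serviceRate k x.2 * S.share k x.1| ≤ ∑ d, |S.serviceRate k d| := by
  rw [abs_mul, abs_of_nonneg (S.share_nonneg k x.1)]
  exact (mul_le_of_le_one_right (abs_nonneg _) (S.share_le_one k x.1)).trans (abs_le_sum_abs _ _)

theorem integrable_serviceRate_mul_share [IsFiniteMeasure ν] (k : Fin K) :
    Integrable (fun x => S.serviceRate k x.2 * S.share k x.1) ν :=
  integrable_of_bounded (abs_serviceRate_mul_share_le k)

/-- The test function `M_k` has increments at most one, so no moment of the queue length is needed.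
-/
theorem IsSteadyState.integral_serviceRate_mul_share (hν : S.IsSteadyState ν) {p : Fin D → ℝ}
    (hp : S.IsInvariantEnv p) (k : Fin K) :
    ∫ x, S.serviceRate k x.2 * S.share k x.1 ∂ν = S.avgArrivalRate p k := by
  have := hν.1
  have h0 := hν.integral_generatorFun (f := fun y => (y.1 k : ℝ)) (B := fun _ => 1)
    (integrable_const _) (fun _ => zero_le_one) (fun _ _ _ _ => le_rfl)
    (fun m _ j => abs_cast_add_single m j k) (fun m _ j => abs_cast_sub_single m j k)
    (fun _ _ _ => by simp)
  simp only [generatorFun_coord] at h0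
  rw [integral_sub (integrable_of_bounded fun x => abs_le_sum_abs (S.arrivalRate k) x.2)
    (integrable_serviceRate_mul_share k), hν.integral_snd hp] at h0
  rw [avgArrivalRate, ← sub_eq_zero.1 h0, dotProduct]
  exact Finset.sum_congr rfl fun _ _ => mul_comm _ _

/-! ### Strict stability -/

/-- A stationary distribution that charges a state charges the states reached by a departure. -/
theorem IsSteadyState.measureReal_sub_single_pos (hν : S.IsSteadyState ν) {m : Fin K → ℕ}
    {d : Fin D} {k : Fin K} (hk : m k ≠ 0) (hd : 0 < S.c d) (h : 0 < ν.real {(m, d)}) :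
    0 < ν.real {(m - Pi.single k 1, d)} := by
  have := hν.1
  refine measureReal_nonneg.lt_of_ne' fun h0 => ?_
  set y : (Fin K → ℕ) × Fin D := (m - Pi.single k 1, d) with hy
  -- If `y` has no mass, the generator of its indicator is nonnegative almost everywhere with
  -- integral zero, so it vanishes at every atom; yet at `(m, d)` the departure into `y` makes it
  -- positive.
  let f : (Fin K → ℕ) × Fin D → ℝ := Set.indicator {y} 1
  have hf0 : ∀ x, 0 ≤ f x := fun x => Set.indicator_nonneg (fun _ _ => zero_le_one) x
  have hf1 : ∀ x, |f x| ≤ 1 := fun x => by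
    rw [abs_of_nonneg (hf0 x)]; exact Set.indicator_le_self' (fun _ _ => zero_le_one) x
  have hterm : ∀ x ≠ y, 0 ≤ ∑ k, S.arrivalRate k x.2 * (f (x.1 + Pi.single k 1, x.2) - f x) ∧
      (∀ j, 0 ≤ S.serviceRate j x.2 * S.share j x.1 * (f (x.1 - Pi.single j 1, x.2) - f x)) ∧
      0 ≤ ∑ l, S.Q x.2 l * (f (x.1, l) - f x) := fun x hx => by
    have hfx : f x = 0 := Set.indicator_of_notMem (by simpa using hx) _
    refine ⟨Finset.sum_nonneg fun k _ => ?_, fun j => ?_, Finset.sum_nonneg fun l _ => ?_⟩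
    · rw [hfx, sub_zero]; exact mul_nonneg (S.arrivalRate_nonneg _ _) (hf0 _)
    · rw [hfx, sub_zero]
      exact mul_nonneg (mul_nonneg (S.serviceRate_nonneg _ _) (S.share_nonneg _ _)) (hf0 _)
    · rcases eq_or_ne x.2 l with rfl | hl
      · simp
      · rw [hfx, sub_zero]; exact mul_nonneg (S.Q_offDiag_nonneg _ _ hl) (hf0 _)
  have hae : 0 ≤ᵐ[ν] S.generatorFun f := by
    have hy0 : ν {y} = 0 := (measureReal_eq_zero_iff).1 h0
    have : ∀ᵐ x ∂ν, x ≠ y := by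
      rw [ae_iff]; simpa using hy0
    filter_upwards [this] with x hx
    obtain ⟨a, b, c⟩ := hterm x hx
    exact add_nonneg (add_nonneg a (Finset.sum_nonneg fun j _ => b j)) c
  have hzero := (integral_eq_zero_iff_of_nonneg_ae hae
    (integrable_of_bounded (S.abs_generatorFun_le_of_bounded hf1))).1
    (hν.integral_generatorFun_of_bounded hf1)
  have hx : S.generatorFun f (m, d) = 0 := by
    by_contra hne
    have h2 : ν {(m, d)} = 0 :=
      measure_mono_null (Set.singleton_subset_iff.2 hne) (ae_iff.1 hzero)
    exact h.ne' ((measureReal_eq_zero_iff).2 h2)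
  have hne : (m, d) ≠ y := fun h => by
    have := congrFun (congrArg Prod.fst h) k
    simp [hy] at this; omega
  obtain ⟨a, b, c⟩ := hterm _ hne
  have h3 : 0 < S.serviceRate k d * S.share k m * (f (m - Pi.single k 1, d) - f (m, d)) := by
    have e1 : f (m - Pi.single k 1, d) = 1 := Set.indicator_of_mem (Set.mem_singleton _) _
    have e2 : f (m, d) = 0 := Set.indicator_of_notMem (by simpa using hne) _
    rw [e1, e2, sub_zero, mul_one]
    exact mul_pos (mul_pos (S.mu_pos k) hd) (S.share_pos hk)
  have h4 := h3.trans_le (Finset.single_le_sum (f := fun j => S.serviceRate j d * S.share j m *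
    (f (m - Pi.single j 1, d) - f (m, d))) (fun j _ => b j) (Finset.mem_univ k))
  exact (add_pos_of_pos_of_nonneg (add_pos_of_nonneg_of_pos a h4) c).ne' hx

/-- A stationary distribution charges the empty queue in each environment state with positive
capacity that it charges at all. -/
theorem IsSteadyState.measureReal_zero_pos (hν : S.IsSteadyState ν) {d : Fin D} (hd : 0 < S.c d)
    (n : ℕ) : ∀ m : Fin K → ℕ, ∑ k, m k = n → 0 < ν.real {(m, d)} → 0 < ν.real {(0, d)} := by
  induction n with
  | zero =>
    intro m hm h
    have : m = 0 := funext fun k => by simpa using Finset.sum_eq_zero_iff.1 hm k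
    rwa [← this]
  | succ n ih =>
    intro m hm h
    obtain ⟨k, -, hk⟩ := Finset.exists_ne_zero_of_sum_ne_zero (hm.trans_ne n.succ_ne_zero)
    refine ih _ ?_ (hν.measureReal_sub_single_pos hk hd h)
    have : m = (m - Pi.single k 1) + Pi.single k 1 := by
      ext j
      rcases eq_or_ne j k with rfl | hj
      · simp; omega
      · simp [hj]
    rw [this] at hm
    simp only [Pi.add_apply, Finset.sum_add_distrib] at hm
    simpa using hm

/-- Work that arrives per unit of time in environment state `d`. -/
noncomputable def load (S : ModulatedDPS K D) (d : Fin D) : ℝ := ∑ k, S.arrivalRate k d / S.mu k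

/-- Weighting rate conservation by `1 / μ_k` and summing shows that the load is the mean capacity in
use, `E[c_Z; M ≠ 0]`. The gap to `p ⬝ᵥ S.c` is `E[c_Z; M = 0]`. -/
theorem IsSteadyState.dotProduct_load_lt (hν : S.IsSteadyState ν) {p : Fin D → ℝ}
    (hp : S.IsInvariantEnv p) (k : Fin K) : p ⬝ᵥ S.load < p ⬝ᵥ S.c := by
  have := hν.1
  have hpos : 0 < S.avgArrivalRate p k := by
    obtain ⟨d, hd⟩ := S.exists_arrival_pos k
    exact Finset.sum_pos' (fun d _ => mul_nonneg (S.arrivalRate_nonneg k d) (hp.1 d))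
      ⟨d, Finset.mem_univ d, mul_pos hd (hp.pos d)⟩
  -- Class `k` arrives at a positive mean rate, so it must also be served in some charged state.
  obtain ⟨x, hx⟩ : ∃ x : (Fin K → ℕ) × Fin D, 0 < S.c x.2 ∧ 0 < ν.real {x} := by
    by_contra! h
    have : ∀ᵐ x ∂ν, S.serviceRate k x.2 * S.share k x.1 = 0 := by
      rw [ae_iff_of_countable]
      intro x hx
      have hc : S.c x.2 = 0 := by
        refine ((S.c_nonneg _).eq_or_lt.resolve_right fun hc => hx ?_).symm
        exact (measureReal_eq_zero_iff).1 ((h x hc).antisymm measureReal_nonneg)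
      simp [serviceRate, hc]
    rw [← hν.integral_serviceRate_mul_share hp, integral_congr_ae this] at hpos
    simp at hpos
  have h0 := hν.measureReal_zero_pos hx.1 _ x.1 rfl hx.2
  have hload : p ⬝ᵥ S.load = ∫ x, S.c x.2 * (if x.1 = 0 then 0 else 1) ∂ν := by
    have e : ∀ x : (Fin K → ℕ) × Fin D, S.c x.2 * (if x.1 = 0 then 0 else 1) =
        ∑ k, (S.mu k)⁻¹ * (S.serviceRate k x.2 * S.share k x.1) := fun x => by
      have : ∀ k, (S.mu k)⁻¹ * (S.serviceRate k x.2 * S.share k x.1) =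
          S.c x.2 * S.share k x.1 := fun k => by
        have := (S.mu_pos k).ne'
        rw [serviceRate]; field_simp
      simp only [this, ← Finset.mul_sum]
      split_ifs with h
      · simp [h, share]
      · rw [S.sum_share h]
    simp only [e]
    rw [integral_finsetSum _ fun k _ => (integrable_serviceRate_mul_share k).const_mul _]
    simp only [integral_const_mul, hν.integral_serviceRate_mul_share hp, dotProduct, load,
      avgArrivalRate, Finset.mul_sum]
    rw [Finset.sum_comm]
    exact Finset.sum_congr rfl fun _ _ => Finset.sum_congr rfl fun _ _ => by ring
  rw [hload, ← hν.integral_snd hp, ← sub_pos]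
  have hc : Integrable (fun x => S.c x.2) ν := integrable_of_bounded fun x => abs_le_sum_abs S.c x.2
  have hc' : Integrable (fun x => S.c x.2 * (if x.1 = 0 then 0 else 1)) ν :=
    integrable_of_bounded (C := ∑ d, |S.c d|) fun x => by
      refine le_trans ?_ (abs_le_sum_abs S.c x.2)
      split_ifs <;> simp
  rw [← integral_sub hc hc', integral_pos_iff_support_of_nonneg]
  · refine lt_of_lt_of_le ?_ (measure_mono (s := {((0 : Fin K → ℕ), x.2)})
      (Set.singleton_subset_iff.2 ?_))
    · exact (ENNReal.toReal_pos_iff.1 h0).1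
    · simpa using hx.1.ne'
  · intro x
    simp only [Pi.zero_apply]
    split_ifs <;> simp [S.c_nonneg]
  · exact hc.sub hc'

end ModulatedDPS

/-! ### A bounded substitute for the square -/

/-- The tent of height `N` on the interval `[0, 2 N]`. -/
def tent (N : ℕ) (v : ℝ) : ℝ := max 0 (min v (2 * N - v))

theorem tent_nonneg (N : ℕ) (v : ℝ) : 0 ≤ tent N v := le_max_left _ _

theorem tent_le (N : ℕ) (v : ℝ) : tent N v ≤ N := by
  refine max_le (Nat.cast_nonneg _) ?_
  rcases le_total v N with h | h
  · exact (min_le_left _ _).trans h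
  · exact (min_le_right _ _).trans (by linarith)

theorem tent_le_self (N : ℕ) {v : ℝ} (hv : 0 ≤ v) : tent N v ≤ v := max_le hv (min_le_left _ _)

theorem tent_eq_self {N : ℕ} {v : ℝ} (hv : 0 ≤ v) (h : v ≤ N) : tent N v = v := by
  rw [tent, min_eq_left (by linarith), max_eq_right hv]

theorem tent_eq_zero {N : ℕ} {v : ℝ} (h : 2 * N ≤ v) : tent N v = 0 :=
  max_eq_left ((min_le_right _ _).trans (by linarith))

theorem abs_tent_sub_le (N : ℕ) (v w : ℝ) : |tent N v - tent N w| ≤ |v - w| := by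
  refine (abs_max_sub_max_le_max _ _ _ _).trans (max_le (by simp) ?_)
  refine (abs_min_sub_min_le_max _ _ _ _).trans (max_le le_rfl ?_)
  rw [abs_sub_comm v w]; exact le_of_eq (by congr 1; ring)

theorem continuous_tent (N : ℕ) : Continuous (tent N) := by
  unfold tent; fun_prop

/-- The primitive of `tent N`: a bounded function that agrees with `v ^ 2 / 2` on `[0, N]`. -/
noncomputable def tentPrimitive (N : ℕ) (v : ℝ) : ℝ := ∫ s in (0 : ℝ)..v, tent N s

/-- First-order Taylor expansion: the derivative `tent N` is 1-Lipschitz, which makes the error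
uniform in `N`. -/
theorem abs_tentPrimitive_sub_le (N : ℕ) (v w : ℝ) :
    |tentPrimitive N w - tentPrimitive N v - tent N v * (w - v)| ≤ (w - v) ^ 2 := by
  have hi : ∀ a b : ℝ, IntervalIntegrable (tent N) volume a b := fun a b =>
    (continuous_tent N).intervalIntegrable a b
  have e : tentPrimitive N w - tentPrimitive N v - tent N v * (w - v) =
      ∫ s in v..w, (tent N s - tent N v) := by
    rw [tentPrimitive, tentPrimitive, intervalIntegral.integral_interval_sub_left (hi _ _) (hi _ _),
      intervalIntegral.integral_sub (hi _ _) intervalIntegrable_const]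
    simp [mul_comm]
  have := intervalIntegral.norm_integral_le_of_norm_le_const (a := v) (b := w) (C := |w - v|)
    (f := fun s => tent N s - tent N v) fun s hs => by
      refine (abs_tent_sub_le N s v).trans ?_
      exact Set.abs_sub_left_of_mem_uIcc (Set.uIoc_subset_uIcc hs)
  rw [e]
  refine this.trans_eq ?_
  rw [← sq, sq_abs]

/-- The tent comes back to zero at `2 N`, so its primitive is constant from there on; a mere cut-off
`min v N` would have an unbounded primitive. -/
theorem abs_tentPrimitive_le (N : ℕ) {v : ℝ} (hv : 0 ≤ v) : |tentPrimitive N v| ≤ 2 * N * N := by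
  have hb : ∀ w : ℝ, |tentPrimitive N w| ≤ N * |w| := fun w => by
    simpa [tentPrimitive] using intervalIntegral.norm_integral_le_of_norm_le_const (a := 0) (b := w)
      (f := tent N) (C := N) fun s _ => by
        rw [Real.norm_eq_abs, abs_of_nonneg (tent_nonneg N s)]; exact tent_le N s
  rcases le_total v (2 * N) with h | h
  · refine (hb v).trans ?_
    rw [abs_of_nonneg hv]; nlinarith [Nat.cast_nonneg (α := ℝ) N]
  · have e : tentPrimitive N v = tentPrimitive N (2 * N) := by
      have h1 : ∫ s in (2 * N : ℝ)..v, tent N s = 0 := by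
        refine (intervalIntegral.integral_congr fun s hs => ?_).trans
          intervalIntegral.integral_zero
        rw [Set.uIcc_of_le h] at hs
        exact tent_eq_zero hs.1
      rw [tentPrimitive, tentPrimitive, ← intervalIntegral.integral_add_adjacent_intervals
        (b := 2 * N) ((continuous_tent N).intervalIntegrable _ _)
        ((continuous_tent N).intervalIntegrable _ _), h1, add_zero]
    rw [e]
    refine (hb _).trans ?_
    rw [abs_of_nonneg (by positivity)]; linarith

namespace ModulatedDPS

variable {K D : ℕ} {S : ModulatedDPS K D} {ν : Measure ((Fin K → ℕ) × Fin D)}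

/-! ### Finiteness of the mean queue lengths -/

/-- The mean workload, corrected by a function of the environment. -/
noncomputable def potential (S : ModulatedDPS K D) (h : Fin D → ℝ)
    (x : (Fin K → ℕ) × Fin D) : ℝ :=
  ∑ k, (x.1 k : ℝ) / S.mu k + h x.2

theorem potential_add_single (h : Fin D → ℝ) (m : Fin K → ℕ) (d : Fin D) (k : Fin K) :
    S.potential h (m + Pi.single k 1, d) - S.potential h (m, d) = 1 / S.mu k := by
  simp only [potential, cast_add_single, add_div, Finset.sum_add_distrib, ite_div, zero_div]
  simp

theorem potential_sub_single (h : Fin D → ℝ) {m : Fin K → ℕ} (d : Fin D) {k : Fin K}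
    (hk : m k ≠ 0) :
    S.potential h (m - Pi.single k 1, d) - S.potential h (m, d) = -(1 / S.mu k) := by
  simp only [potential, cast_sub_single _ _ _ hk, sub_div, Finset.sum_sub_distrib, ite_div,
    zero_div]
  simp

/-- While the queue is nonempty the shares sum to one and work leaves at rate `c_d`, however
capacity is divided. The last term undoes this for the empty queue. -/
theorem generatorFun_potential (h : Fin D → ℝ) (x : (Fin K → ℕ) × Fin D) :
    S.generatorFun (S.potential h) x =
      S.load x.2 - S.c x.2 + S.Q.mulVec h x.2 + (if x.1 = 0 then S.c x.2 else 0) := by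
  have e1 : ∀ k, S.serviceRate k x.2 * S.share k x.1 *
      (S.potential h (x.1 - Pi.single k 1, x.2) - S.potential h x) =
      -(S.c x.2 * S.share k x.1) := fun k => by
    rw [mul_assoc, share_mul_congr fun hk => potential_sub_single h x.2 hk]
    have := (S.mu_pos k).ne'
    rw [serviceRate]; field_simp
  have e2 : ∀ l, S.potential h (x.1, l) - S.potential h x = h l - h x.2 := fun l => by
    simp [potential]
  have e3 : ∀ k, S.potential h (x.1 + Pi.single k 1, x.2) - S.potential h x = 1 / S.mu k :=
    fun k => potential_add_single h x.1 x.2 k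
  have e4 : ∑ l, S.Q x.2 l * (h l - h x.2) = S.Q.mulVec h x.2 := by
    simp [Matrix.mulVec, dotProduct, mul_sub, Finset.sum_sub_distrib, ← Finset.sum_mul,
      S.Q_row_sum]
  simp only [generatorFun, e1, e2, e3, e4, mul_one_div, Finset.sum_neg_distrib, ← Finset.mul_sum]
  rw [← load]
  split_ifs with h0
  · simp only [h0, share, Pi.zero_apply, Nat.cast_zero, mul_zero, zero_div,
      Finset.sum_const_zero]
    ring
  · rw [S.sum_share h0]; ring

theorem potential_nonneg {h : Fin D → ℝ} (hh : ∀ d, 0 ≤ h d) (x : (Fin K → ℕ) × Fin D) :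
    0 ≤ S.potential h x :=
  add_nonneg (Finset.sum_nonneg fun k _ => div_nonneg (Nat.cast_nonneg _) (S.mu_pos k).le) (hh _)

/-- The Poisson equation replaces the net load of each environment state by its average. Adding a
constant makes `h` nonnegative and is not seen by `Q`. -/
theorem IsInvariantEnv.exists_potential {p : Fin D → ℝ} (hp : S.IsInvariantEnv p) :
    ∃ h : Fin D → ℝ, (∀ d, 0 ≤ h d) ∧ ∀ x, S.generatorFun (S.potential h) x =
      -(p ⬝ᵥ S.c - p ⬝ᵥ S.load) + (if x.1 = 0 then S.c x.2 else 0) := by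
  obtain ⟨h, hh⟩ := hp.exists_mulVec_eq
    (r := S.c - S.load - (p ⬝ᵥ S.c - p ⬝ᵥ S.load) • 1) (by
      rw [dotProduct_sub, dotProduct_smul, hp.dotProduct_one, dotProduct_sub]; simp)
  refine ⟨h + fun _ => ∑ l, |h l|, fun d => ?_, fun x => ?_⟩
  · have := neg_abs_le (h d)
    have := abs_le_sum_abs h d
    simp only [Pi.add_apply]; linarith
  · have hc : S.Q.mulVec (fun _ => ∑ l, |h l|) = 0 := by
      ext d
      simp [Matrix.mulVec, dotProduct, ← Finset.sum_mul, S.Q_row_sum]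
    rw [generatorFun_potential, Matrix.mulVec_add, hc, hh]
    simp only [add_zero, Pi.sub_apply, Pi.smul_apply, Pi.one_apply, smul_eq_mul]
    ring

/-- To first order the generator maps `tentPrimitive N ∘ V` to `tent N V` times the drift of `V`.
Its mean is zero and the drift is `-ε` off the empty queue, so `ε E[tent N V]` is at most the
remainder, uniformly in `N`. -/
theorem IsSteadyState.exists_integral_tent_le (hν : S.IsSteadyState ν) {h : Fin D → ℝ}
    (hh : ∀ d, 0 ≤ h d) {ε : ℝ} (hε : 0 < ε)
    (hdrift : ∀ x, S.generatorFun (S.potential h) x = -ε + (if x.1 = 0 then S.c x.2 else 0)) :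
    ∃ C, ∀ N, ∫ x, tent N (S.potential h x) ∂ν ≤ C := by
  have := hν.1
  set H := ∑ d, h d
  have hH : ∀ d, h d ≤ H := fun d => Finset.single_le_sum (fun d _ => hh d) (Finset.mem_univ d)
  have hH0 : 0 ≤ H := Finset.sum_nonneg fun d _ => hh d
  set R := ∑ k, 1 / S.mu k
  have hR0 : ∀ k, 0 ≤ 1 / S.mu k := fun k => (one_div_pos.2 (S.mu_pos k)).le
  have hR : ∀ k, 1 / S.mu k ≤ R := fun k =>
    Finset.single_le_sum (f := fun k => 1 / S.mu k) (fun k _ => hR0 k) (Finset.mem_univ k)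
  have hR0' : 0 ≤ R := Finset.sum_nonneg fun k _ => hR0 k
  -- `R` bounds the jumps of the workload and `H` those of `h`, so `b` bounds the Taylor remainder
  -- of any transition.
  set b := (R + H) ^ 2
  have hc : ∀ d, S.c d ≤ ∑ l, S.c l := fun d =>
    Finset.single_le_sum (fun d _ => S.c_nonneg d) (Finset.mem_univ d)
  set C := S.rateBound * b + H * ∑ l, S.c l
  have hpt : ∀ N x, ε * tent N (S.potential h x) ≤
      C - S.generatorFun (fun y => tentPrimitive N (S.potential h y)) x := fun N x => by
    have key : ∀ y, |S.potential h y - S.potential h x| ≤ R + H →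
        |(tentPrimitive N (S.potential h y) - tent N (S.potential h x) * S.potential h y) -
          (tentPrimitive N (S.potential h x) - tent N (S.potential h x) * S.potential h x)| ≤ b :=
      fun y hy => by
        have h1 := abs_tentPrimitive_sub_le N (S.potential h x) (S.potential h y)
        have h2 : (S.potential h y - S.potential h x) ^ 2 ≤ b := by
          rw [← sq_abs]; exact pow_le_pow_left₀ (abs_nonneg _) hy 2
        refine le_trans (le_of_eq ?_) (h1.trans h2)
        congr 1; ring
    have h3 := S.abs_generatorFun_le (x := x)
      (f := fun y => tentPrimitive N (S.potential h y) -
        tent N (S.potential h x) * S.potential h y) (b := b) (sq_nonneg _)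
      (fun k => key _ (by
        rw [show S.potential h x = S.potential h (x.1, x.2) from rfl, potential_add_single,
          abs_of_nonneg (hR0 k)]
        linarith [hR k]))
      (fun k => key _ (by
        by_cases hk : x.1 k = 0
        · rw [sub_single_of_eq_zero hk]; simp; linarith
        · rw [show S.potential h x = S.potential h (x.1, x.2) from rfl,
            potential_sub_single _ _ hk, abs_neg, abs_of_nonneg (hR0 k)]
          linarith [hR k]))
      (fun l => key _ (by
        have e : S.potential h (x.1, l) - S.potential h x = h l - h x.2 := by simp [potential]
        rw [e, abs_le]
        constructor <;> linarith [hH l, hH x.2, hh l, hh x.2]))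
    rw [generatorFun_sub_mul, hdrift] at h3
    -- On the empty queue the potential is just `h`, hence at most `H`.
    have h4 : tent N (S.potential h x) * (if x.1 = 0 then S.c x.2 else 0) ≤ H * ∑ l, S.c l := by
      split_ifs with h0
      · refine mul_le_mul ?_ (hc _) (S.c_nonneg _) hH0
        refine (tent_le_self N (potential_nonneg hh x)).trans ?_
        simpa [potential, h0] using hH x.2
      · rw [mul_zero]; exact mul_nonneg hH0 (Finset.sum_nonneg fun d _ => S.c_nonneg d)
    have h5 := (abs_le.1 h3).2
    rw [mul_add] at h5
    simp only [C]
    linarith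
  refine ⟨C / ε, fun N => ?_⟩
  have hbd : ∀ x, |tentPrimitive N (S.potential h x)| ≤ 2 * N * N := fun x =>
    abs_tentPrimitive_le N (potential_nonneg hh x)
  have hi1 : Integrable (fun x => tent N (S.potential h x)) ν :=
    integrable_of_bounded (C := N) fun x => by
      rw [abs_of_nonneg (tent_nonneg _ _)]; exact tent_le _ _
  have hi2 : Integrable (S.generatorFun fun y => tentPrimitive N (S.potential h y)) ν :=
    integrable_of_bounded (S.abs_generatorFun_le_of_bounded hbd)
  have h6 := integral_mono (hi1.const_mul ε) ((integrable_const C).sub hi2) (hpt N)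
  rw [integral_const_mul, integral_sub' (integrable_const C) hi2,
    hν.integral_generatorFun_of_bounded hbd] at h6
  rw [le_div_iff₀ hε, mul_comm]
  simpa using h6

/-- The sets `V ≤ N` exhaust the state space and `tent N V = V` there, so the uniform bound passes
to `V`, which dominates `M_k / μ_k`. -/
theorem IsSteadyState.integrable_coord (hν : S.IsSteadyState ν) {p : Fin D → ℝ}
    (hp : S.IsInvariantEnv p) (k : Fin K) : Integrable (fun x => (x.1 k : ℝ)) ν := by
  have := hν.1
  obtain ⟨h, hh, hdrift⟩ := hp.exists_potential
  obtain ⟨C, hC⟩ := hν.exists_integral_tent_le hh (sub_pos.2 (hν.dotProduct_load_lt hp k)) hdrift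
  have hcover : AECover ν Filter.atTop fun N : ℕ => {x | S.potential h x ≤ N} :=
    ⟨ae_of_all _ fun x => by
      filter_upwards [Filter.eventually_ge_atTop ⌈S.potential h x⌉₊] with N hN
      exact Nat.ceil_le.1 hN, fun N => MeasurableSet.of_discrete⟩
  have hi1 : ∀ N, Integrable (fun x => tent N (S.potential h x)) ν := fun N =>
    integrable_of_bounded (C := N) fun x => by
      rw [abs_of_nonneg (tent_nonneg _ _)]; exact tent_le _ _
  have heq : ∀ N : ℕ, Set.EqOn (S.potential h) (fun x => tent N (S.potential h x))
      {x | S.potential h x ≤ N} := fun N x hx => (tent_eq_self (potential_nonneg hh x) hx).symm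
  have hV : Integrable (S.potential h) ν := by
    refine hcover.integrable_of_integral_bounded_of_nonneg_ae C (fun N => ?_)
      (ae_of_all _ fun x => potential_nonneg hh x) (Filter.Eventually.of_forall fun N => ?_)
    · exact (integrableOn_congr_fun (heq N) MeasurableSet.of_discrete).2 (hi1 N).integrableOn
    · rw [setIntegral_congr_fun MeasurableSet.of_discrete (heq N)]
      exact (setIntegral_le_integral (hi1 N) (ae_of_all _ fun x => tent_nonneg _ _)).trans (hC N)
  refine (hV.const_mul (S.mu k)).mono' Measurable.of_discrete.aestronglyMeasurable
    (ae_of_all _ fun x => ?_)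
  rw [Real.norm_eq_abs, abs_of_nonneg (Nat.cast_nonneg _), ← div_le_iff₀' (S.mu_pos k)]
  have h1 := Finset.single_le_sum (f := fun k => (x.1 k : ℝ) / S.mu k)
    (fun k _ => div_nonneg (Nat.cast_nonneg _) (S.mu_pos k).le) (Finset.mem_univ k)
  exact h1.trans (le_add_of_nonneg_right (hh _))

/-! ### Second moments -/

theorem abs_mul_sub_mul_le {a b a' b' : ℝ} (ha : 0 ≤ a) (hb : 0 ≤ b) (h : |a' - a| ≤ 1)
    (h' : |b' - b| ≤ 1) : |a' * b' - a * b| ≤ a + b + 1 := by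
  have e : a' * b' - a * b = (a' - a) * (b' - b) + (a' - a) * b + a * (b' - b) := by ring
  rw [e]
  refine (abs_add_three _ _ _).trans ?_
  rw [abs_mul, abs_mul, abs_mul, abs_of_nonneg ha, abs_of_nonneg hb]
  nlinarith [mul_le_one₀ h (abs_nonneg _) h', mul_le_mul_of_nonneg_right h hb,
    mul_le_mul_of_nonneg_left h' ha]

/-- A product rule; a single jump moves both factors only when `j = k`, whence the last term. -/
theorem generatorFun_coord_mul_coord (j k : Fin K) (x : (Fin K → ℕ) × Fin D) :
    S.generatorFun (fun y => (y.1 j : ℝ) * (y.1 k : ℝ)) x =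
      S.arrivalRate j x.2 * x.1 k + S.arrivalRate k x.2 * x.1 j
        - S.serviceRate j x.2 * S.share j x.1 * x.1 k
        - S.serviceRate k x.2 * S.share k x.1 * x.1 j
        + (if j = k then S.arrivalRate k x.2 + S.serviceRate k x.2 * S.share k x.1 else 0) := by
  have h₁ : ∀ i, S.arrivalRate i x.2 *
      (((x.1 + Pi.single i 1 : Fin K → ℕ) j : ℝ) * ((x.1 + Pi.single i 1 : Fin K → ℕ) k : ℝ)
        - x.1 j * x.1 k) =
      (if j = i then S.arrivalRate i x.2 * x.1 k else 0)
        + (if k = i then S.arrivalRate i x.2 * x.1 j else 0)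
        + (if k = i then (if j = i then S.arrivalRate i x.2 else 0) else 0) := fun i => by
    rw [cast_add_single, cast_add_single]
    split_ifs <;> ring
  have h₂ : ∀ i, S.serviceRate i x.2 * S.share i x.1 *
      (((x.1 - Pi.single i 1 : Fin K → ℕ) j : ℝ) * ((x.1 - Pi.single i 1 : Fin K → ℕ) k : ℝ)
        - x.1 j * x.1 k) =
      (if j = i then -(S.serviceRate i x.2 * S.share i x.1 * x.1 k) else 0)
        + (if k = i then -(S.serviceRate i x.2 * S.share i x.1 * x.1 j) else 0)
        + (if k = i then (if j = i then S.serviceRate i x.2 * S.share i x.1 else 0) else 0) :=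
      fun i => by
    rw [mul_assoc, share_mul_congr (b := (x.1 j - (if j = i then (1 : ℝ) else 0)) *
      (x.1 k - (if k = i then 1 else 0)) - x.1 j * x.1 k) fun hi => by
      rw [cast_sub_single _ _ _ hi, cast_sub_single _ _ _ hi]]
    split_ifs <;> ring
  simp only [generatorFun, h₁, h₂, Finset.sum_add_distrib, Finset.sum_ite_eq, Finset.mem_univ,
    if_true, sub_self, mul_zero, Finset.sum_const_zero]
  split_ifs <;> ring

theorem integrable_mul_of_bounded {u F : (Fin K → ℕ) × Fin D → ℝ} {C : ℝ}
    (hF : Integrable F ν) (hu : ∀ x, |u x| ≤ C) : Integrable (fun x => u x * F x) ν :=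
  hF.bdd_mul Measurable.of_discrete.aestronglyMeasurable (ae_of_all _ hu)

/-- Stationarity of the product of two queue lengths. -/
theorem IsSteadyState.second_moment_balance (hν : S.IsSteadyState ν) {p : Fin D → ℝ}
    (hp : S.IsInvariantEnv p) (j k : Fin K) :
    (∫ x, S.serviceRate j x.2 * S.share j x.1 * x.1 k ∂ν)
        + ∫ x, S.serviceRate k x.2 * S.share k x.1 * x.1 j ∂ν =
      (∫ x, S.arrivalRate j x.2 * x.1 k ∂ν) + (∫ x, S.arrivalRate k x.2 * x.1 j ∂ν)
        + if j = k then 2 * S.avgArrivalRate p k else 0 := by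
  have := hν.1
  have hj := hν.integrable_coord hp j
  have hk := hν.integrable_coord hp k
  -- The increments of the product grow linearly, so finite first moments suffice and no second
  -- moment is assumed.
  have h0 := hν.integral_generatorFun (f := fun y => (y.1 j : ℝ) * (y.1 k : ℝ))
    (B := fun y => (y.1 j : ℝ) + (y.1 k : ℝ) + 1) ((hj.add hk).add (integrable_const 1))
    (fun _ => by positivity) (fun m n _ h => by
      have h1 : (m j : ℝ) ≤ n j := Nat.cast_le.2 (h j)
      have h2 : (m k : ℝ) ≤ n k := Nat.cast_le.2 (h k)
      simp only; linarith)
    (fun m _ i => abs_mul_sub_mul_le (Nat.cast_nonneg _) (Nat.cast_nonneg _)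
      (abs_cast_add_single m i j) (abs_cast_add_single m i k))
    (fun m _ i => abs_mul_sub_mul_le (Nat.cast_nonneg _) (Nat.cast_nonneg _)
      (abs_cast_sub_single m i j) (abs_cast_sub_single m i k))
    (fun m _ _ => by simp only [sub_self, abs_zero]; positivity)
  simp only [generatorFun_coord_mul_coord] at h0
  have i₁ : Integrable (fun x => S.arrivalRate j x.2 * (x.1 k : ℝ)) ν :=
    integrable_mul_of_bounded hk fun x => abs_le_sum_abs (S.arrivalRate j) x.2
  have i₂ : Integrable (fun x => S.arrivalRate k x.2 * (x.1 j : ℝ)) ν :=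
    integrable_mul_of_bounded hj fun x => abs_le_sum_abs (S.arrivalRate k) x.2
  have i₃ : Integrable (fun x => S.serviceRate j x.2 * S.share j x.1 * (x.1 k : ℝ)) ν :=
    integrable_mul_of_bounded hk (abs_serviceRate_mul_share_le j)
  have i₄ : Integrable (fun x => S.serviceRate k x.2 * S.share k x.1 * (x.1 j : ℝ)) ν :=
    integrable_mul_of_bounded hj (abs_serviceRate_mul_share_le k)
  have i₅ : Integrable (fun x => S.arrivalRate k x.2) ν :=
    integrable_of_bounded fun x => abs_le_sum_abs (S.arrivalRate k) x.2
  have i₆ : Integrable (fun x => S.serviceRate k x.2 * S.share k x.1) ν :=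
    integrable_serviceRate_mul_share k
  have e₅ : ∫ x, S.arrivalRate k x.2 ∂ν = S.avgArrivalRate p k := by
    rw [hν.integral_snd hp, avgArrivalRate, dotProduct]
    exact Finset.sum_congr rfl fun _ _ => mul_comm _ _
  have i₇ : Integrable (fun x : (Fin K → ℕ) × Fin D => if j = k then
      S.arrivalRate k x.2 + S.serviceRate k x.2 * S.share k x.1 else 0) ν := by
    split_ifs
    · exact i₅.add i₆
    · exact integrable_zero _ _ _
  have e₇ : (∫ x : (Fin K → ℕ) × Fin D, if j = k then
      S.arrivalRate k x.2 + S.serviceRate k x.2 * S.share k x.1 else 0 ∂ν) =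
      if j = k then 2 * S.avgArrivalRate p k else 0 := by
    split_ifs
    · rw [integral_add i₅ i₆, e₅, hν.integral_serviceRate_mul_share hp]; ring
    · simp
  rw [integral_add ?_ i₇, integral_sub ?_ i₄, integral_sub ?_ i₃, integral_add i₁ i₂, e₇] at h0
  · linarith
  · exact i₁.add i₂
  · exact (i₁.add i₂).sub i₃
  · exact ((i₁.add i₂).sub i₃).sub i₄

/-- The capacity-weighted mean queue length of class `k` in terms of the arrival-weighted ones. -/
theorem IsSteadyState.integral_c_mul_coord (hν : S.IsSteadyState ν) {p : Fin D → ℝ}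
    (hp : S.IsInvariantEnv p) (k : Fin K) :
    ∫ x, S.c x.2 * x.1 k ∂ν = S.avgArrivalRate p k / S.mu k +
      ∑ j, S.g j * ((∫ x, S.arrivalRate k x.2 * x.1 j ∂ν) + ∫ x, S.arrivalRate j x.2 * x.1 k ∂ν) /
        (S.mu k * S.g k + S.mu j * S.g j) := by
  have := hν.1
  let w : Fin K → (Fin K → ℕ) × Fin D → ℝ := fun j x => S.c x.2 * S.share j x.1 * x.1 k
  have hw : ∀ j, ∫ x, w j x ∂ν = S.g j *
      ((∫ x, S.arrivalRate k x.2 * x.1 j ∂ν) + (∫ x, S.arrivalRate j x.2 * x.1 k ∂ν)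
        + if j = k then 2 * S.avgArrivalRate p k else 0) /
        (S.mu k * S.g k + S.mu j * S.g j) := fun j => by
    have hgj := S.g_pos j
    have hpos : 0 < S.mu k * S.g k + S.mu j * S.g j :=
      add_pos (mul_pos (S.mu_pos k) (S.g_pos k)) (mul_pos (S.mu_pos j) hgj)
    have hb := hν.second_moment_balance hp j k
    have e₁ : ∀ x : (Fin K → ℕ) × Fin D,
        S.serviceRate j x.2 * S.share j x.1 * x.1 k = S.mu j * w j x := fun x => by
      simp only [w, serviceRate]; ring
    -- The symmetry special to discriminatory processor sharing: `g_j share_k m_j = g_k share_j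
    -- m_k`.
    have e₂ : ∀ x : (Fin K → ℕ) × Fin D,
        S.serviceRate k x.2 * S.share k x.1 * x.1 j = S.mu k * S.g k / S.g j * w j x := fun x => by
      simp only [w, serviceRate, share]; field_simp
    simp only [e₁, e₂, integral_const_mul] at hb
    rw [eq_div_iff hpos.ne', add_comm (∫ x, S.arrivalRate k x.2 * x.1 j ∂ν), ← hb]
    field_simp
    ring
  have hsum : ∀ x : (Fin K → ℕ) × Fin D, S.c x.2 * x.1 k = ∑ j, w j x := fun x => by
    simp only [w, ← Finset.sum_mul, ← Finset.mul_sum]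
    -- The shares do not sum to one on the empty queue, but there `m_k = 0`.
    by_cases h : x.1 = 0
    · simp [h]
    · rw [S.sum_share h, mul_one]
  have hwi : ∀ j, Integrable (w j) ν := fun j =>
    integrable_mul_of_bounded (C := ∑ d, |S.c d|) (hν.integrable_coord hp k) fun x => by
      rw [abs_mul, abs_of_nonneg (S.share_nonneg j x.1)]
      exact (mul_le_of_le_one_right (abs_nonneg _) (S.share_le_one j x.1)).trans
        (abs_le_sum_abs _ _)
  simp only [hsum]
  rw [integral_finsetSum _ fun j _ => hwi j]
  simp only [hw, mul_add, add_div, Finset.sum_add_distrib, mul_ite, mul_zero, ite_div, zero_div,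
    Finset.sum_ite_eq', Finset.mem_univ, if_true]
  have h₁ := S.mu_pos k
  have h₂ := S.g_pos k
  -- The squared jumps in the diagonal term `j = k` produce `λ_{k,∞} / μ_k`.
  have e : S.g k * (2 * S.avgArrivalRate p k) / (S.mu k * S.g k + S.mu k * S.g k) =
      S.avgArrivalRate p k / S.mu k := by
    field_simp; ring
  rw [e]; ring

/-! ### Splitting over environment states and transfer to random variables -/

theorem integral_env_mul {F : (Fin K → ℕ) × Fin D → ℝ} (hF : Integrable F ν) (u : Fin D → ℝ) :
    ∫ x, u x.2 * F x ∂ν = ∑ d, u d * ∫ x, F x * (if x.2 = d then 1 else 0) ∂ν := by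
  simp only [← integral_const_mul]
  rw [← integral_finsetSum]
  · congr 1; ext x
    simp
  · intro d _
    refine Integrable.const_mul ?_ _
    simp only [mul_comm (F _)]
    exact integrable_mul_of_bounded (C := 1) hF fun x => by split_ifs <;> simp

end ModulatedDPS

theorem mainTheorem5 {K D : ℕ} (S : ModulatedDPS K D)
    (π : Fin D → ℝ) (hπ : S.IsInvariantEnv π)
    {Ω : Type*} [MeasurableSpace Ω] (P : Measure Ω)
    (M : Ω → Fin K → ℕ) (Z : Ω → Fin D) (hM : Measurable M) (hZ : Measurable Z)
    (hstat : S.IsSteadyState (P.map fun ω => (M ω, Z ω))) :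
    (∀ k, S.avgArrivalRate π k =
      ∑ d, S.serviceRate k d *
        ∫ ω, S.g k * (M ω k : ℝ) / (∑ j, S.g j * (M ω j : ℝ))
          * (if 0 < ∑ j, M ω j then 1 else 0) * (if Z ω = d then 1 else 0) ∂P) ∧
    (∀ k, Integrable (fun ω => (M ω k : ℝ)) P) ∧
    ∀ k, ∑ d, S.c d * ∫ ω, (M ω k : ℝ) * (if Z ω = d then 1 else 0) ∂P =
      S.avgArrivalRate π k / S.mu k +
        ∑ d, ∑ j, S.g j *
          ((S.arrivalRate k d * ∫ ω, (M ω j : ℝ) * (if Z ω = d then 1 else 0) ∂P)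
            + S.arrivalRate j d * ∫ ω, (M ω k : ℝ) * (if Z ω = d then 1 else 0) ∂P)
          / (S.mu k * S.g k + S.mu j * S.g j) := by
  have hMZ : Measurable fun ω => (M ω, Z ω) := hM.prodMk hZ
  set ν := P.map fun ω => (M ω, Z ω) with hν
  have := hstat.1
  have hmap : ∀ F : (Fin K → ℕ) × Fin D → ℝ, ∫ ω, F (M ω, Z ω) ∂P = ∫ x, F x ∂ν := fun F =>
    (integral_map hMZ.aemeasurable Measurable.of_discrete.aestronglyMeasurable).symm
  have hcoord : ∀ k d, ∫ ω, (M ω k : ℝ) * (if Z ω = d then 1 else 0) ∂P =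
      ∫ x, (x.1 k : ℝ) * (if x.2 = d then 1 else 0) ∂ν := fun k d =>
    hmap fun x => (x.1 k : ℝ) * (if x.2 = d then 1 else 0)
  refine ⟨fun k => ?_, fun k => ?_, fun k => ?_⟩
  · have hshare : ∀ d, ∫ ω, S.g k * (M ω k : ℝ) / (∑ j, S.g j * (M ω j : ℝ))
          * (if 0 < ∑ j, M ω j then 1 else 0) * (if Z ω = d then 1 else 0) ∂P =
        ∫ x, S.share k x.1 * (if x.2 = d then 1 else 0) ∂ν := fun d => by
      rw [← hmap fun x => S.share k x.1 * (if x.2 = d then 1 else 0)]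
      refine integral_congr_ae (ae_of_all _ fun ω => ?_)
      change _ = S.share k (M ω) * _
      simp only [ModulatedDPS.share]
      congr 1
      -- On the empty queue the quotient is already `0` by the convention for division by zero, so
      -- the indicator changes nothing.
      by_cases h : 0 < ∑ j, M ω j
      · rw [if_pos h, mul_one]
      · have h0 : M ω k = 0 :=
          Finset.sum_eq_zero_iff.1 (Nat.eq_zero_of_not_pos h) k (Finset.mem_univ k)
        simp [h0]
    simp only [hshare]
    rw [← ModulatedDPS.integral_env_mul (F := fun x => S.share k x.1)
      (ModulatedDPS.integrable_of_bounded (C := 1) fun x => by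
        rw [abs_of_nonneg (S.share_nonneg k x.1)]; exact S.share_le_one k x.1),
      hstat.integral_serviceRate_mul_share hπ]
  · exact (hstat.integrable_coord hπ k).comp_measurable hMZ
  · have henv : ∀ (u : Fin D → ℝ) k, ∑ d, u d * ∫ x, (x.1 k : ℝ) * (if x.2 = d then 1 else 0) ∂ν =
        ∫ x, u x.2 * (x.1 k : ℝ) ∂ν := fun u k =>
      (ModulatedDPS.integral_env_mul (hstat.integrable_coord hπ k) u).symm
    simp only [hcoord]
    rw [Finset.sum_comm, henv, hstat.integral_c_mul_coord hπ]
    simp only [← Finset.sum_div, ← Finset.mul_sum, Finset.sum_add_distrib, henv]
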